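/- Let $n\ge 2$, let $\Gamma_0,\dots,\Gamma_{n-1}$ be phase spaces (smooth symplectic manifolds, finite-dimensional, Hausdorff and second countable) with their Liouville measures $\mu_0,\dots,\mu_{n-1}$, and let a Lie group $G$ (finite-dimensional, Hausdorff and second countable) act smoothly on each $\Gamma_k$, preserving $\mu_k$. Put $\Gamma^{(n)}=\Gamma_0\times\cdots\times\Gamma_{n-1}$ with the product measure $\mu_0\times\cdots\times\mu_{n-1}$. Let $\mathcal B^{(n)}$ be the algebra of those $f\in L^\infty(\Gamma^{(n)})$ that are $G$-invariant, i.e. for every $g\in G$, $f(gx_0,\dots,gx_{n-1})=f(x_0,\dots,x_{n-1})$ for almost all $(x_0,\dots,x_{n-1})$; it acts on $L^2(\Gamma^{(n)})$ by multiplication. For $1\le k\le n-1$ let $\mathcal B^{(n)}_{0k}\subset\mathcal B^{(n)}$ be the subalgebra of the functions $(x_0,\dots,x_{n-1})\mapsto f(x_0,x_k)$, where $f\in L^\infty(\Gamma_0\times\Gamma_k)$ is $G$-invariant in the same sense. Assume that $G$ acts freely on $\Gamma_0$ (for every $x_0\in\Gamma_0$, $gx_0=x_0$ implies $g=e$) and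 that there is a submanifold $\hat\Gamma_0\subset\Gamma_0$ that meets every $G$-orbit in $\Gamma_0$ in exactly one point and is transverse to the orbit there, i.e. the vectors tangent to $\hat\Gamma_0$ and those tangent to the orbit together generate the tangent space of $\Gamma_0$ at this point. Then $\mathcal B^{(n)}$ is the von Neumann algebra on $L^2(\Gamma^{(n)})$ generated by the $n-1$ subalgebras $\mathcal B^{(n)}_{0k}$, $k=1,\dots,n-1$ (the double commutant of their union). In other words, the object $F_0$ with phase space $\Gamma_0$ satisfies the condition for defining a reference frame: $\mathcal B^{(n)}$ is generated by the subalgebras $\mathcal B^{(n)}_{0k}$ with $k\ne 0$. -/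

import Mathlib

open MeasureTheory Set
open scoped Manifold ContDiff ENNReal

noncomputable section

section Symplectic

variable {d : ℕ} {M : Type*} [TopologicalSpace M] [ChartedSpace (EuclideanSpace ℝ (Fin d)) M]

/-- The expression of a field of alternating bilinear forms on `M` in a chart `φ`: the pull-back
under `φ⁻¹`, a differential 2-form on the target of `φ` (only its values there matter). -/
def formInChart (Ω : ∀ x : M, (TangentSpace (𝓡 d) x) [⋀^Fin 2]→L[ℝ] ℝ)
    (φ : OpenPartialHomeomorph M (EuclideanSpace ℝ (Fin d))) (y : EuclideanSpace ℝ (Fin d)) :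
    (EuclideanSpace ℝ (Fin d)) [⋀^Fin 2]→L[ℝ] ℝ :=
  (Ω (φ.symm y)).compContinuousLinearMap (mfderiv (𝓡 d) (𝓡 d) φ.symm y)

variable (d M) in
/-- A symplectic form on the `d`-dimensional manifold `M`: a smooth, closed, nondegenerate
differential 2-form. -/
structure SymplecticForm where
  /-- The value of the form at a point. -/
  form : ∀ x : M, (TangentSpace (𝓡 d) x) [⋀^Fin 2]→L[ℝ] ℝ
  smooth : ∀ φ ∈ atlas (EuclideanSpace ℝ (Fin d)) M, ContDiffOn ℝ ∞ (formInChart form φ) φ.target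
  closed : ∀ φ ∈ atlas (EuclideanSpace ℝ (Fin d)) M, ∀ y ∈ φ.target,
    extDeriv (formInChart form φ) y = 0
  nondegenerate : ∀ (x : M) (v : TangentSpace (𝓡 d) x), (∀ w, form x ![v, w] = 0) → v = 0

/-- The density, with respect to Lebesgue measure in the chart `φ`, of the Liouville volume
`|Ω ^ m / m!|` (`d = 2 m`), that is `|Pf (Ω_ij)| = √(det (Ω_ij))`. -/
def SymplecticForm.density (Ω : SymplecticForm d M)
    (φ : OpenPartialHomeomorph M (EuclideanSpace ℝ (Fin d))) (y : EuclideanSpace ℝ (Fin d)) : ℝ :=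
  √(Matrix.det (Matrix.of fun i j : Fin d =>
    formInChart Ω.form φ y ![EuclideanSpace.single i 1, EuclideanSpace.single j 1]))

/-- `μ` is the Liouville measure of the symplectic form `Ω`: in every chart of the atlas it has the
Liouville density. (As the charts cover `M`, this determines the Borel measure `μ` when `M` is
second countable.) -/
def SymplecticForm.IsLiouville [MeasurableSpace M] (Ω : SymplecticForm d M) (μ : Measure M) :
    Prop :=
  ∀ φ ∈ atlas (EuclideanSpace ℝ (Fin d)) M, ∀ A ⊆ φ.source, MeasurableSet A →
    μ A = ∫⁻ y in φ '' A, ENNReal.ofReal (Ω.density φ y)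

end Symplectic

section Transversal

/-- The tangent space at `x` of the orbit through `x`: the range of the derivative at `1` of the
orbit map `g ↦ g • x`. -/
def orbitTangentSpace {p d : ℕ} (G : Type*) [Group G] [TopologicalSpace G]
    [ChartedSpace (EuclideanSpace ℝ (Fin p)) G] {M : Type*} [TopologicalSpace M]
    [ChartedSpace (EuclideanSpace ℝ (Fin d)) M] [MulAction G M] (x : M) :
    Submodule ℝ (TangentSpace (𝓡 d) x) :=
  (mfderiv (𝓡 p) (𝓡 d) (fun g : G => g • x) 1).range

/-- The immersed submanifold `ι : S → M` (embedded submanifolds are a special case) meets every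
`G`-orbit in exactly one point, and it meets the orbits transversely there: the tangent vectors of
the two submanifolds together generate the tangent space of `M`. (The first requirement
makes `ι` injective.) -/
structure IsTransverseSection {p s d : ℕ} (G : Type*) [Group G] [TopologicalSpace G]
    [ChartedSpace (EuclideanSpace ℝ (Fin p)) G] {M : Type*} [TopologicalSpace M]
    [ChartedSpace (EuclideanSpace ℝ (Fin d)) M] [MulAction G M] {S : Type*} [TopologicalSpace S]
    [ChartedSpace (EuclideanSpace ℝ (Fin s)) S] (ι : S → M) : Prop where
  immersion : Manifold.IsImmersion (𝓡 s) (𝓡 d) ∞ ι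
  existsUnique_mem_orbit : ∀ x : M, ∃! y : S, ι y ∈ MulAction.orbit G x
  transverse : ∀ y : S,
    (mfderiv (𝓡 s) (𝓡 d) ι y).range ⊔ orbitTangentSpace (p := p) G (ι y) = ⊤

end Transversal

section Algebras

/-- The von Neumann algebra generated by a set `s` of bounded operators: the double commutant of
the self-adjoint set `s ∪ s*`. -/
def vonNeumannGenerated {H : Type*} [NormedAddCommGroup H] [InnerProductSpace ℂ H]
    [CompleteSpace H] (s : Set (H →L[ℂ] H)) : VonNeumannAlgebra H where
  toStarSubalgebra := StarSubalgebra.centralizer ℂ (Set.centralizer (s ∪ star s))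
  centralizer_centralizer' := by
    simp

theorem coe_vonNeumannGenerated {H : Type*} [NormedAddCommGroup H] [InnerProductSpace ℂ H]
    [CompleteSpace H] (s : Set (H →L[ℂ] H)) :
    (vonNeumannGenerated s : Set (H →L[ℂ] H)) =
      Set.centralizer (Set.centralizer (s ∪ star s)) := by
  have h : star (Set.centralizer (s ∪ star s)) = Set.centralizer (s ∪ star s) := by
    rw [← StarSubalgebra.coe_centralizer ℂ s]
    ext x
    rw [Set.mem_star, SetLike.mem_coe, SetLike.mem_coe, star_mem_iff]
  change ((StarSubalgebra.centralizer ℂ (Set.centralizer (s ∪ star s)) : Set (H →L[ℂ] H))) = _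
  rw [StarSubalgebra.coe_centralizer, h, Set.union_self]

variable {X : Type*} [MeasurableSpace X]

/-- The representation of `L^∞` by multiplication operators on `L²`. -/
def mulOp (μ : Measure X) : Lp ℂ ∞ μ →L[ℂ] (Lp ℂ 2 μ →L[ℂ] Lp ℂ 2 μ) :=
  (ContinuousLinearMap.mul ℂ ℂ).holderL μ ∞ 2 2

/-- The `G`-invariant elements of `L^∞`: for every `g`, `f (g x) = f x` for almost all `x`. -/
def invariantLinfty (G : Type*) [SMul G X] (μ : Measure X) : Set (Lp ℂ ∞ μ) :=
  {f | ∀ g : G, (fun x => f (g • x)) =ᵐ[μ] f}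

variable {n : ℕ} {Γ : Fin n → Type*} [∀ k, MeasurableSpace (Γ k)]
  (G : Type*) [∀ k, SMul G (Γ k)] (μ : ∀ k, Measure (Γ k))

/-- `ℬ⁽ⁿ⁾`: the invariant `L^∞` functions on `Γ₀ × ⋯ × Γₙ₋₁` (product measure, diagonal action),
acting on `L²` by multiplication. -/
def invariantAlgebra : Set (Lp ℂ 2 (Measure.pi μ) →L[ℂ] Lp ℂ 2 (Measure.pi μ)) :=
  mulOp (Measure.pi μ) '' invariantLinfty G (Measure.pi μ)

/-- `ℬ⁽ⁿ⁾_{ik}`: the operators of multiplication by `(x₀, …, xₙ₋₁) ↦ f (xᵢ, xₖ)`, where `f` is an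
invariant `L^∞` function on `Γᵢ × Γₖ`. -/
def pairAlgebra (i k : Fin n) : Set (Lp ℂ 2 (Measure.pi μ) →L[ℂ] Lp ℂ 2 (Measure.pi μ)) :=
  mulOp (Measure.pi μ) '' {F | ∃ f ∈ invariantLinfty G ((μ i).prod (μ k)),
    F =ᵐ[Measure.pi μ] fun x => f (x i, x k)}

/-- The object `F_j` defines a reference frame: `ℬ⁽ⁿ⁾` is the von Neumann algebra generated by the
`n - 1` subalgebras `ℬ⁽ⁿ⁾_{jk}`, `k ≠ j`. -/
def SatisfiesFrameAssumption (j : Fin n) : Prop :=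
  (vonNeumannGenerated (⋃ k ∈ {k : Fin n | k ≠ j}, pairAlgebra G μ j k) : Set _) =
    invariantAlgebra G μ

end Algebras

end

/-!
By transversality, the map `G × S → Γ₀`, `(g, y) ↦ g • ι y`, is a submersion at the points `(1, y)`,
and by equivariance it is open everywhere. Since the section meets each orbit once and the action
is free, the map is bijective, hence a homeomorphism, and its inverse yields a continuous map
`γ : Γ₀ → G` with `γ (g • x) = g * γ x` (`IsTransverseSection.exists_continuous_equivariant`).
This argument does not need `S` to be second countable.

Put `Φ x = (γ x₀)⁻¹ • x`. The components of `Φ` are invariant and the `k`-th one depends on `x₀` and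
`xₖ` only. If `f` is invariant almost everywhere under each `g`, then by Fubini `f (g • x) = f x`
for almost all `x` and Haar-almost all `g`. As right translations preserve the null sets of Haar
measure, `f` is almost everywhere equal to the average of `f` over the orbit, computed from the
base point `Φ x`, and this is a function of `Φ x` (`exists_ae_eq_comp_inv_smul`).

Let `T` commute with the pair algebras. The sets whose indicator functions commute with `T` form a
`σ`-algebra `commutingSets T`. It contains the sets `{x | (Φ x)ₖ ∈ B}`, so it contains the
`σ`-algebra generated by `Φ`, and therefore `T` commutes with every bounded function of `Φ`
(`commute_mulOp_of_stronglyMeasurable`). Hence the invariant functions lie in the double commutant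
of the pair algebras.

Conversely, an operator in this double commutant commutes with all of `L^∞`, which is its own
commutant on `L²` of a `σ`-finite measure (`exists_mulOp_eq_of_commute`), so it is multiplication by
some `f`. It also commutes with the unitaries `ψ ↦ ψ (g • ·)`, and this means that `f` is invariant.
Liouville measures are `σ`-finite because their densities are continuous.
-/

/-! ### Multiplication operators -/

section MultiplicationOperators

variable {X : Type*} [MeasurableSpace X] {μ : Measure X}

theorem mulOp_apply_ae (f : Lp ℂ ∞ μ) (ψ : Lp ℂ 2 μ) :
    mulOp μ f ψ =ᵐ[μ] fun x => f x * ψ x := by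
  simpa [mulOp] using (ContinuousLinearMap.mul ℂ ℂ).coeFn_holder (r := 2) f ψ

theorem commute_mulOp (f g : Lp ℂ ∞ μ) : Commute (mulOp μ f) (mulOp μ g) := by
  refine ContinuousLinearMap.ext fun ψ => Lp.ext ?_
  simp only [mul_apply_eq_comp]
  filter_upwards [mulOp_apply_ae f (mulOp μ g ψ), mulOp_apply_ae g (mulOp μ f ψ),
    mulOp_apply_ae f ψ, mulOp_apply_ae g ψ] with x h1 h2 h3 h4
  rw [h1, h2, h3, h4]
  ring

theorem star_mulOp (f : Lp ℂ ∞ μ) : star (mulOp μ f) = mulOp μ (star f) := by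
  rw [ContinuousLinearMap.star_eq_adjoint, eq_comm, ContinuousLinearMap.eq_adjoint_iff]
  intro φ ψ
  rw [L2.inner_def, L2.inner_def]
  refine integral_congr_ae ?_
  filter_upwards [mulOp_apply_ae f ψ, mulOp_apply_ae (star f) φ, Lp.coeFn_star f] with x h1 h2 h3
  rw [h1, h2, h3]
  simp
  ring

/-- The indicator function of a measurable set, of finite or infinite measure, as an element of
`L^∞`. -/
noncomputable def indicatorLinfty (μ : Measure X) (A : Set X) (hA : MeasurableSet A) :
    Lp ℂ ∞ μ :=
  MemLp.toLp (A.indicator fun _ => (1 : ℂ)) <|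
    memLp_top_of_bound ((measurable_const.indicator hA).aestronglyMeasurable) 1 <|
      .of_forall fun x => by by_cases hx : x ∈ A <;> simp [hx]

theorem indicatorLinfty_ae (A : Set X) (hA : MeasurableSet A) :
    indicatorLinfty μ A hA =ᵐ[μ] A.indicator fun _ => 1 :=
  MemLp.coeFn_toLp _

theorem mulOp_indicatorLinfty_ae (A : Set X) (hA : MeasurableSet A) (ψ : Lp ℂ 2 μ) :
    mulOp μ (indicatorLinfty μ A hA) ψ =ᵐ[μ] A.indicator ψ := by
  filter_upwards [mulOp_apply_ae (indicatorLinfty μ A hA) ψ, indicatorLinfty_ae A hA] with x h1 h2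
  rw [h1, h2]
  by_cases hx : x ∈ A <;> simp [hx]

theorem mulOp_indicatorLinfty_compl (A : Set X) (hA : MeasurableSet A) :
    mulOp μ (indicatorLinfty μ Aᶜ hA.compl) = 1 - mulOp μ (indicatorLinfty μ A hA) := by
  refine ContinuousLinearMap.ext fun ψ => Lp.ext ?_
  simp only [sub_apply, one_apply_eq_self]
  filter_upwards [mulOp_indicatorLinfty_ae A hA ψ, mulOp_indicatorLinfty_ae Aᶜ hA.compl ψ,
    Lp.coeFn_sub ψ (mulOp μ (indicatorLinfty μ A hA) ψ)] with x h1 h2 h3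
  rw [h2, h3, Pi.sub_apply, h1]
  by_cases hx : x ∈ A <;> simp [hx]

theorem mulOp_indicatorLinfty_inter (A B : Set X) (hA : MeasurableSet A) (hB : MeasurableSet B) :
    mulOp μ (indicatorLinfty μ (A ∩ B) (hA.inter hB)) =
      mulOp μ (indicatorLinfty μ A hA) * mulOp μ (indicatorLinfty μ B hB) := by
  refine ContinuousLinearMap.ext fun ψ => Lp.ext ?_
  simp only [mul_apply_eq_comp]
  filter_upwards [mulOp_indicatorLinfty_ae B hB ψ,
    mulOp_indicatorLinfty_ae A hA (mulOp μ (indicatorLinfty μ B hB) ψ),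
    mulOp_indicatorLinfty_ae (A ∩ B) (hA.inter hB) ψ] with x h1 h2 h3
  rw [h3, h2]
  by_cases hx : x ∈ A <;> by_cases hx' : x ∈ B <;> simp [hx, hx', h1]

/-- A matrix coefficient of the commutator of an operator with multiplication by `f` is the integral
of `f` against an integrable function that does not depend on `f`. -/
theorem exists_inner_commutator_eq_integral (T : Lp ℂ 2 μ →L[ℂ] Lp ℂ 2 μ) (φ ψ : Lp ℂ 2 μ) :
    ∃ h : X → ℂ, Integrable h μ ∧ ∀ f : Lp ℂ ∞ μ,
      inner ℂ φ ((T * mulOp μ f - mulOp μ f * T) ψ) = ∫ x, f x * h x ∂μ := by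
  refine ⟨fun x => inner ℂ (T.adjoint φ x) (ψ x) - inner ℂ (φ x) (T ψ x),
    (L2.integrable_inner _ _).sub (L2.integrable_inner _ _), fun f => ?_⟩
  rw [sub_apply, mul_apply_eq_comp, mul_apply_eq_comp, inner_sub_right,
    ← ContinuousLinearMap.adjoint_inner_left, L2.inner_def, L2.inner_def,
    ← integral_sub (L2.integrable_inner _ _) (L2.integrable_inner _ _)]
  refine integral_congr_ae ?_
  filter_upwards [mulOp_apply_ae f ψ, mulOp_apply_ae f (T ψ)] with x h1 h2
  rw [h1, h2]
  simp
  ring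

theorem commute_mulOp_iff_inner (T : Lp ℂ 2 μ →L[ℂ] Lp ℂ 2 μ) (f : Lp ℂ ∞ μ) :
    Commute T (mulOp μ f) ↔
      ∀ φ ψ : Lp ℂ 2 μ, inner ℂ φ ((T * mulOp μ f - mulOp μ f * T) ψ) = 0 := by
  rw [commute_iff_eq, ← sub_eq_zero]
  refine ⟨fun h φ ψ => by rw [h, zero_apply, inner_zero_right], fun h => ?_⟩
  ext1 ψ
  exact inner_self_eq_zero.1 (h _ ψ)

/-- Commutation with `T` passes to increasing unions, because the matrix coefficients of the
commutator are set integrals. -/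
theorem commute_mulOp_indicatorLinfty_iUnion (T : Lp ℂ 2 μ →L[ℂ] Lp ℂ 2 μ) {A : ℕ → Set X}
    (hA : ∀ i, MeasurableSet (A i)) (hmono : Monotone A)
    (h : ∀ i, Commute T (mulOp μ (indicatorLinfty μ (A i) (hA i)))) :
    Commute T (mulOp μ (indicatorLinfty μ (⋃ i, A i) (.iUnion hA))) := by
  rw [commute_mulOp_iff_inner]
  intro φ ψ
  obtain ⟨k, hk, hT⟩ := exists_inner_commutator_eq_integral T φ ψ
  have key (B : Set X) (hB : MeasurableSet B) :
      ∫ x, indicatorLinfty μ B hB x * k x ∂μ = ∫ x in B, k x ∂μ := by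
    rw [← integral_indicator hB]
    refine integral_congr_ae ?_
    filter_upwards [indicatorLinfty_ae (μ := μ) B hB] with x hx
    rw [hx]
    by_cases hxB : x ∈ B <;> simp [hxB]
  have hz (i : ℕ) : ∫ x in A i, k x ∂μ = 0 := by
    rw [← key _ (hA i), ← hT, (commute_mulOp_iff_inner _ _).1 (h i)]
  rw [hT, key]
  have := tendsto_setIntegral_of_monotone hA hmono hk.integrableOn
  simp only [hz] at this
  exact tendsto_nhds_unique this tendsto_const_nhds

/-- The measurable sets `A` such that the operator `T` on `L²` commutes with multiplication by the
indicator function of `A`. -/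
@[reducible] def commutingSets (T : Lp ℂ 2 μ →L[ℂ] Lp ℂ 2 μ) : MeasurableSpace X where
  MeasurableSet' A := ∃ hA : MeasurableSet A, Commute T (mulOp μ (indicatorLinfty μ A hA))
  measurableSet_empty := by
    refine ⟨.empty, ?_⟩
    have : indicatorLinfty μ (∅ : Set X) .empty = 0 := by
      refine Lp.ext ?_
      filter_upwards [indicatorLinfty_ae (μ := μ) (∅ : Set X) .empty, Lp.coeFn_zero ℂ ∞ μ]
        with x h1 h2
      rw [h1, h2]
      simp
    rw [this, map_zero]
    exact Commute.zero_right T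
  measurableSet_compl := by
    rintro A ⟨hA, h⟩
    refine ⟨hA.compl, ?_⟩
    rw [mulOp_indicatorLinfty_compl A hA]
    exact (Commute.one_right T).sub_right h
  measurableSet_iUnion := by
    intro A h
    have hAm i := (h i).1
    -- finite unions, through complements and intersections
    have hunion (B C : Set X)
        (hB : ∃ hA : MeasurableSet B, Commute T (mulOp μ (indicatorLinfty μ B hA)))
        (hC : ∃ hA : MeasurableSet C, Commute T (mulOp μ (indicatorLinfty μ C hA))) :
        ∃ hA : MeasurableSet (B ∪ C), Commute T (mulOp μ (indicatorLinfty μ (B ∪ C) hA)) := by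
      obtain ⟨hB, hTB⟩ := hB
      obtain ⟨hC, hTC⟩ := hC
      refine ⟨hB.union hC, ?_⟩
      have h1 : B ∪ C = (Bᶜ ∩ Cᶜ)ᶜ := by rw [compl_inter, compl_compl, compl_compl]
      simp only [h1]
      rw [mulOp_indicatorLinfty_compl _ (hB.compl.inter hC.compl),
        mulOp_indicatorLinfty_inter _ _ hB.compl hC.compl, mulOp_indicatorLinfty_compl B hB,
        mulOp_indicatorLinfty_compl C hC]
      have h1 := Commute.one_right T
      exact h1.sub_right ((h1.sub_right hTB).mul_right (h1.sub_right hTC))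
    have hacc (i : ℕ) : ∃ hA : MeasurableSet (accumulate A i),
        Commute T (mulOp μ (indicatorLinfty μ (accumulate A i) hA)) := by
      induction i with
      | zero => simpa only [accumulate_zero_nat] using h 0
      | succ i ih => simpa only [accumulate_succ] using hunion _ _ ih (h (i + 1))
    refine ⟨.iUnion hAm, ?_⟩
    have := commute_mulOp_indicatorLinfty_iUnion T (fun i => (hacc i).1) monotone_accumulate
      fun i => (hacc i).2
    simpa only [iUnion_accumulate] using this

theorem ae_norm_le_norm_Linfty (f : Lp ℂ ∞ μ) : ∀ᵐ x ∂μ, ‖f x‖ ≤ ‖f‖ := by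
  filter_upwards [ae_le_eLpNormEssSup (f := f) (μ := μ)] with x hx
  rw [← eLpNorm_exponent_top] at hx
  rw [Lp.norm_def, ← toReal_enorm]
  exact ENNReal.toReal_mono (Lp.eLpNorm_ne_top f) hx

end MultiplicationOperators

section SubSigmaAlgebra

/-- If an operator commutes with the indicator functions of a sub-`σ`-algebra, it commutes with
every bounded function that is measurable with respect to it. -/
theorem commute_mulOp_of_stronglyMeasurable {X : Type*} {m m₀ : MeasurableSpace X}
    {μ : Measure X} (T : Lp ℂ 2 μ →L[ℂ] Lp ℂ 2 μ) (hm : m ≤ commutingSets T) (f : Lp ℂ ∞ μ)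
    {F : X → ℂ} (hF : StronglyMeasurable[m] F) (hfF : f =ᵐ[μ] F) : Commute T (mulOp μ f) := by
  rw [commute_mulOp_iff_inner]
  intro φ ψ
  obtain ⟨k, hk, hT⟩ := exists_inner_commutator_eq_integral T φ ψ
  have hle : m ≤ m₀ := fun A hA => (hm A hA).1
  have hind (A : Set X) (hA : MeasurableSet[m] A) : ∫ x in A, k x ∂μ = 0 := by
    obtain ⟨hA', hTA⟩ := hm A hA
    rw [← (commute_mulOp_iff_inner _ _).1 hTA φ ψ, hT, ← integral_indicator hA']
    refine integral_congr_ae ?_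
    filter_upwards [indicatorLinfty_ae (μ := μ) A hA'] with x hx
    rw [hx]
    by_cases hxB : x ∈ A <;> simp [hxB]
  have hint (g : @SimpleFunc X m ℂ) : Integrable (fun x => g x * k x) μ := by
    obtain ⟨c, hc⟩ := @SimpleFunc.exists_forall_norm_le X ℂ m _ g
    exact hk.bdd_mul (c := c)
      ((@SimpleFunc.measurable X ℂ m _ g).mono hle le_rfl).aestronglyMeasurable
      (.of_forall hc)
  have hsimple (g : @SimpleFunc X m ℂ) : ∫ x, g x * k x ∂μ = 0 := by
    refine @SimpleFunc.induction X ℂ m _ (fun g => ∫ x, g x * k x ∂μ = 0)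
      (fun c A hA => ?_) (fun g₁ g₂ _ h1 h2 => ?_) g
    · trans ∫ x, A.indicator (fun x => c * k x) x ∂μ
      · congr 1
        ext x
        by_cases hx : x ∈ A <;> simp [hx]
      rw [integral_indicator (hle A hA), integral_const_mul, hind A hA, mul_zero]
    · have : (fun x => (g₁ + g₂) x * k x) = fun x => g₁ x * k x + g₂ x * k x := by
        ext x
        simp [add_mul]
      rw [this, integral_add (hint _) (hint _), h1, h2, add_zero]
  have hbound : ∀ᵐ x ∂μ, ‖F x‖ ≤ ‖f‖ := by
    filter_upwards [hfF, ae_norm_le_norm_Linfty f] with x h1 h2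
    rwa [← h1]
  rw [hT]
  have hlim : Filter.Tendsto (fun i => ∫ x, hF.approxBounded ‖f‖ i x * k x ∂μ) Filter.atTop
      (nhds (∫ x, f x * k x ∂μ)) := by
    refine tendsto_integral_of_dominated_convergence (fun x => ‖f‖ * ‖k x‖)
      (fun i => (hint _).aestronglyMeasurable) (hk.norm.const_mul _)
      (fun i => .of_forall fun x => ?_) ?_
    · rw [norm_mul]
      gcongr
      exact hF.norm_approxBounded_le (norm_nonneg _) i x
    · filter_upwards [hbound, hfF] with x hx h1
      rw [h1]
      exact (hF.tendsto_approxBounded_of_norm_le hx).mul_const _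
  simp only [hsimple] at hlim
  exact tendsto_nhds_unique hlim tendsto_const_nhds

end SubSigmaAlgebra

/-! ### The commutant of the multiplication algebra -/

section MaximalAbelian

variable {X : Type*} [MeasurableSpace X] {μ : Measure X}

theorem exists_Lp_two_ae_ne_zero (μ : Measure X) [SigmaFinite μ] :
    ∃ ξ : Lp ℂ 2 μ, ∀ᵐ x ∂μ, ξ x ≠ 0 := by
  obtain ⟨g, hpos, hg, hint⟩ := exists_pos_lintegral_lt_of_sigmaFinite μ one_ne_zero
  have hmeas : Measurable fun x => ((√(g x : ℝ) : ℝ) : ℂ) := by fun_prop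
  have hL2 : MemLp (fun x => ((√(g x : ℝ) : ℝ) : ℂ)) 2 μ := by
    rw [← memLp_norm_iff hmeas.aestronglyMeasurable,
      memLp_two_iff_integrable_sq hmeas.norm.aestronglyMeasurable]
    have : Integrable (fun x => (g x : ℝ)) μ := by
      refine ⟨by fun_prop, ?_⟩
      simpa [HasFiniteIntegral] using hint.trans ENNReal.one_lt_top
    refine this.congr (.of_forall fun x => ?_)
    simp
  refine ⟨hL2.toLp, ?_⟩
  filter_upwards [hL2.coeFn_toLp] with x hx
  rw [hx]
  simpa using (hpos x).ne'

theorem norm_sq_Lp_two (ψ : Lp ℂ 2 μ) : ‖ψ‖ ^ 2 = ∫ x, ‖ψ x‖ ^ 2 ∂μ := by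
  have h : ((‖ψ‖ ^ 2 : ℝ) : ℂ) = ((∫ x, ‖ψ x‖ ^ 2 ∂μ : ℝ) : ℂ) := by
    have := inner_self_eq_norm_sq_to_K (𝕜 := ℂ) ψ
    rw [L2.inner_def] at this
    rw [← integral_complex_ofReal]
    push_cast
    rw [← RCLike.ofReal_eq_complex_ofReal, ← this]
    exact integral_congr_ae (.of_forall fun x => by simp)
  exact_mod_cast h

theorem integrable_norm_sq_Lp_two (ψ : Lp ℂ 2 μ) : Integrable (fun x => ‖ψ x‖ ^ 2) μ :=
  (memLp_two_iff_integrable_sq_norm (Lp.aestronglyMeasurable ψ)).1 (Lp.memLp ψ)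

/-- An operator in the commutant satisfies its norm bound pointwise: otherwise the norm bound would
fail for the restriction of `ξ` to the set where the pointwise inequality is violated. -/
theorem ae_norm_apply_le_of_commute (T : Lp ℂ 2 μ →L[ℂ] Lp ℂ 2 μ)
    (hT : ∀ f : Lp ℂ ∞ μ, Commute T (mulOp μ f)) (ξ : Lp ℂ 2 μ) :
    ∀ᵐ x ∂μ, ‖T ξ x‖ ≤ ‖T‖ * ‖ξ x‖ := by
  set A : Set X := {x | ‖T‖ * ‖ξ x‖ < ‖T ξ x‖} with hAdef
  have hA : MeasurableSet A :=
    measurableSet_lt ((Lp.stronglyMeasurable ξ).measurable.norm.const_mul _)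
      (Lp.stronglyMeasurable (T ξ)).measurable.norm
  have hnorm (ψ : Lp ℂ 2 μ) :
      ‖mulOp μ (indicatorLinfty μ A hA) ψ‖ ^ 2 = ∫ x in A, ‖ψ x‖ ^ 2 ∂μ := by
    rw [norm_sq_Lp_two, ← integral_indicator hA]
    refine integral_congr_ae ?_
    filter_upwards [mulOp_indicatorLinfty_ae A hA ψ] with x hx
    rw [hx]
    by_cases hxA : x ∈ A <;> simp [hxA]
  have hle : ∫ x in A, ‖T ξ x‖ ^ 2 ∂μ ≤ ∫ x in A, ‖T‖ ^ 2 * ‖ξ x‖ ^ 2 ∂μ := by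
    rw [integral_const_mul, ← hnorm, ← hnorm, ← mul_pow]
    have : mulOp μ (indicatorLinfty μ A hA) (T ξ) = T (mulOp μ (indicatorLinfty μ A hA) ξ) :=
      (DFunLike.congr_fun (hT (indicatorLinfty μ A hA)).eq ξ).symm
    rw [this]
    gcongr
    exact T.le_opNorm _
  have hi1 := (integrable_norm_sq_Lp_two (T ξ)).integrableOn (s := A)
  have hi2 := ((integrable_norm_sq_Lp_two ξ).const_mul (‖T‖ ^ 2)).integrableOn (s := A)
  have hpos : ∀ x ∈ A, 0 < ‖T ξ x‖ ^ 2 - ‖T‖ ^ 2 * ‖ξ x‖ ^ 2 := by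
    intro x hx
    rw [← mul_pow, sub_pos]
    exact pow_lt_pow_left₀ hx (by positivity) two_ne_zero
  have hzero : μ A = 0 := by
    by_contra hne
    have := (setIntegral_pos_iff_support_of_nonneg_ae
      (f := fun x => ‖T ξ x‖ ^ 2 - ‖T‖ ^ 2 * ‖ξ x‖ ^ 2)
      ((ae_restrict_iff' hA).2 (.of_forall fun x hx => (hpos x hx).le)) (hi1.sub hi2)).2 (by
        rw [inter_eq_right.2 (show A ⊆ Function.support _ from fun x hx => (hpos x hx).ne')]
        exact pos_iff_ne_zero.2 hne)
    rw [integral_sub hi1 hi2] at this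
    linarith
  filter_upwards [measure_eq_zero_iff_ae_notMem.1 hzero] with x hx
  simpa [hAdef] using hx

/-- The multiplication algebra of `L^∞` is its own commutant. An operator `T` in the commutant is
multiplication by `T ξ / ξ`, for any `ξ ∈ L²` without zeros. -/
theorem exists_mulOp_eq_of_commute [SigmaFinite μ] (T : Lp ℂ 2 μ →L[ℂ] Lp ℂ 2 μ)
    (hT : ∀ f : Lp ℂ ∞ μ, Commute T (mulOp μ f)) : ∃ f, mulOp μ f = T := by
  obtain ⟨ξ, hξ⟩ := exists_Lp_two_ae_ne_zero μ
  have hmξ := (Lp.stronglyMeasurable ξ).measurable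
  have hmT := (Lp.stronglyMeasurable (T ξ)).measurable
  have hbd : MemLp (fun x => T ξ x / ξ x) ∞ μ := by
    refine memLp_top_of_bound (hmT.div hmξ).aestronglyMeasurable ‖T‖ ?_
    filter_upwards [hξ, ae_norm_apply_le_of_commute T hT ξ] with x h1 h2
    rwa [norm_div, div_le_iff₀ (norm_pos_iff.2 h1)]
  refine ⟨hbd.toLp, ContinuousLinearMap.ext fun ψ => Lp.ext ?_⟩
  have hmψ := (Lp.stronglyMeasurable ψ).measurable
  -- on the sets `A n`, which exhaust `X`, `ψ` is a bounded multiple of `ξ`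
  set A : ℕ → Set X := fun n => {x | ‖ψ x‖ ≤ n * ‖ξ x‖}
  have hA (n : ℕ) : MeasurableSet (A n) := measurableSet_le hmψ.norm (hmξ.norm.const_mul _)
  have key (n : ℕ) : ∀ᵐ x ∂μ, x ∈ A n → T ψ x = ψ x / ξ x * T ξ x := by
    have hq : MemLp ((A n).indicator fun x => ψ x / ξ x) ∞ μ := by
      refine memLp_top_of_bound ((hmψ.div hmξ).indicator (hA n)).aestronglyMeasurable n ?_
      filter_upwards [hξ] with x h1
      by_cases hx : x ∈ A n
      · rw [indicator_of_mem hx, norm_div, div_le_iff₀ (norm_pos_iff.2 h1)]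
        exact hx
      · simp [hx]
    have h1 : mulOp μ (indicatorLinfty μ (A n) (hA n)) ψ = mulOp μ hq.toLp ξ := by
      refine Lp.ext ?_
      filter_upwards [mulOp_indicatorLinfty_ae (A n) (hA n) ψ, mulOp_apply_ae hq.toLp ξ,
        hq.coeFn_toLp, hξ] with x h1 h2 h3 h4
      rw [h1, h2, h3]
      by_cases hx : x ∈ A n <;> simp [hx, h4]
    have h2 : mulOp μ (indicatorLinfty μ (A n) (hA n)) (T ψ) = mulOp μ hq.toLp (T ξ) := by
      have e1 := DFunLike.congr_fun (hT (indicatorLinfty μ (A n) (hA n))).eq ψ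
      have e2 := DFunLike.congr_fun (hT hq.toLp).eq ξ
      simp only [mul_apply_eq_comp] at e1 e2
      rw [← e1, ← e2, h1]
    have h3 := mulOp_indicatorLinfty_ae (A n) (hA n) (T ψ)
    rw [h2] at h3
    filter_upwards [h3, mulOp_apply_ae hq.toLp (T ξ), hq.coeFn_toLp] with x e1 e2 e3 hx
    rw [e2, e3, indicator_of_mem hx, indicator_of_mem hx] at e1
    exact e1.symm
  filter_upwards [ae_all_iff.2 key, mulOp_apply_ae hbd.toLp ψ, hbd.coeFn_toLp, hξ]
    with x h1 h2 h3 h4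
  obtain ⟨n, hn⟩ := exists_nat_ge (‖ψ x‖ / ‖ξ x‖)
  rw [h1 n ((div_le_iff₀ (norm_pos_iff.2 h4)).1 hn), h2, h3]
  ring

end MaximalAbelian

/-! ### Openness of submersions -/

section Submersion

open Filter Topology

/-- A `C¹` map between manifolds whose derivative at a point is onto is open at that point. -/
theorem ContMDiffAt.map_nhds_eq_of_range_mfderiv_eq_top
    {E E' H H' M N : Type*} [NormedAddCommGroup E] [NormedSpace ℝ E] [CompleteSpace E]
    [NormedAddCommGroup E'] [NormedSpace ℝ E'] [CompleteSpace E'] [TopologicalSpace H]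
    [TopologicalSpace H'] {I : ModelWithCorners ℝ E H} {J : ModelWithCorners ℝ E' H'}
    [I.Boundaryless] [J.Boundaryless] [TopologicalSpace M] [ChartedSpace H M]
    [TopologicalSpace N] [ChartedSpace H' N] {f : M → N} {x : M}
    (hf : ContMDiffAt I J 1 f x) (hsurj : (mfderiv I J f x).range = ⊤) :
    map f (𝓝 x) = 𝓝 (f x) := by
  set w := writtenInExtChartAt I J x f with hw
  have hcont : ContinuousAt f x := hf.continuousAt
  have hcd : ContDiffAt ℝ 1 w (extChartAt I x x) := by
    have := (contMDiffAt_iff.1 hf).2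
    rwa [I.range_eq_univ, contDiffWithinAt_univ] at this
  have hmf : mfderiv I J f x = fderiv ℝ w (extChartAt I x x) := by
    rw [(hf.mdifferentiableAt one_ne_zero).mfderiv, I.range_eq_univ, fderivWithin_univ]
  have hstrict := (hcd.hasStrictFDerivAt one_ne_zero).map_nhds_eq_of_surj
    (by rw [← hmf]; exact hsurj)
  have hsource : ∀ᶠ y in 𝓝 x, y ∈ (extChartAt I x).source := extChartAt_source_mem_nhds x
  have heq : w ∘ extChartAt I x =ᶠ[𝓝 x] extChartAt J (f x) ∘ f := by
    filter_upwards [hsource] with y hy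
    simp only [hw, writtenInExtChartAt, Function.comp_apply, (extChartAt I x).left_inv hy]
  have hwx : w (extChartAt I x x) = extChartAt J (f x) (f x) := heq.eq_of_nhds
  rw [← map_extChartAt_nhds_of_boundaryless (I := I) x, hwx, map_map, Filter.map_congr heq,
    ← map_map, ← map_extChartAt_nhds_of_boundaryless (I := J) (f x)] at hstrict
  have hJ : ∀ l : Filter N, (extChartAt J (f x)).source ∈ l →
      map (extChartAt J (f x)).symm (map (extChartAt J (f x)) l) = l := by
    intro l hl
    rw [map_map]
    refine (Filter.map_congr ?_).trans Filter.map_id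
    filter_upwards [hl] with y hy using (extChartAt J (f x)).left_inv hy
  rw [← hJ (map f (𝓝 x)) (hcont (extChartAt_source_mem_nhds (f x))), hstrict,
    hJ _ (extChartAt_source_mem_nhds (f x))]

end Submersion

/-! ### The equivariant map of a transverse section -/

section EquivariantMap

open Filter Topology

variable {p s d : ℕ} {G : Type*} [Group G] [TopologicalSpace G]
    [ChartedSpace (EuclideanSpace ℝ (Fin p)) G] {M : Type*} [TopologicalSpace M]
    [ChartedSpace (EuclideanSpace ℝ (Fin d)) M] [MulAction G M] {S : Type*} [TopologicalSpace S]
    [ChartedSpace (EuclideanSpace ℝ (Fin s)) S] {ι : S → M}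

/-- By transversality, the action map `(g, y) ↦ g • ι y` of a transverse section is a submersion,
and hence open. -/
theorem IsTransverseSection.isOpenMap_smul [IsManifold (𝓡 p) ∞ G] [IsManifold (𝓡 d) ∞ M]
    [IsManifold (𝓡 s) ∞ S] [ContinuousMul G] [ContMDiffSMul (𝓡 p) (𝓡 d) ∞ G M]
    (hι : IsTransverseSection (p := p) (s := s) (d := d) G ι) :
    IsOpenMap fun q : G × S => q.1 • ι q.2 := by
  have hsm : ContMDiff (𝓡 s) (𝓡 d) ∞ ι := hι.immersion.contMDiff
  have hΨ : ContMDiff ((𝓡 p).prod (𝓡 s)) (𝓡 d) ∞ fun q : G × S => q.1 • ι q.2 :=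
    (contMDiff_smul (I := 𝓡 p) (I' := 𝓡 d) (n := ∞)).comp
      (contMDiff_fst.prodMk (hsm.comp contMDiff_snd))
  have : ContinuousSMul G M := ContMDiffSMul.continuousSMul (I := 𝓡 p) (I' := 𝓡 d) ∞
  have hone (y : S) : map (fun q : G × S => q.1 • ι q.2) (𝓝 (1, y)) = 𝓝 (ι y) := by
    have hat := (hΨ (1, y)).of_le (show (1 : ℕ∞ω) ≤ (∞ : ℕ∞ω) by exact_mod_cast le_top)
    have hmd := hat.mdifferentiableAt one_ne_zero
    have h := hat.map_nhds_eq_of_range_mfderiv_eq_top ?_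
    · simpa using h
    -- the derivative at `(1, y)` restricts to those of `ι` and of the orbit map on the two factors
    have h1 : HasMFDerivAt (𝓡 s) (𝓡 d) ((fun q : G × S => q.1 • ι q.2) ∘ fun z : S => ((1 : G), z))
        y _ := hmd.hasMFDerivAt.comp y
      (mdifferentiableAt_const.prodMk mdifferentiableAt_id).hasMFDerivAt
    have h2 : HasMFDerivAt (𝓡 p) (𝓡 d) ((fun q : G × S => q.1 • ι q.2) ∘ fun g : G => (g, y))
        1 _ := hmd.hasMFDerivAt.comp 1
      (mdifferentiableAt_id.prodMk mdifferentiableAt_const).hasMFDerivAt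
    rw [show ((fun q : G × S => q.1 • ι q.2) ∘ fun z : S => ((1 : G), z)) = ι by
      ext z; simp] at h1
    have hy := hι.transverse y
    refine top_unique (hy.ge.trans (sup_le ?_ ?_))
    · have e : mfderiv (𝓡 s) (𝓡 d) ι y = _ := h1.mfderiv
      rw [e]
      exact LinearMap.range_comp_le_range _ _
    · have e : mfderiv (𝓡 p) (𝓡 d) (fun g : G => g • ι y) 1 = _ := HasMFDerivAt.mfderiv h2
      rw [orbitTangentSpace, e]
      exact LinearMap.range_comp_le_range _ _
  refine IsOpenMap.of_nhds_le ?_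
  rintro ⟨g, y⟩
  -- translation by `g` reduces the claim to the point `(1, y)`
  have htrans : (fun q : G × S => q.1 • ι q.2) =
      (fun x => g • x) ∘ (fun q : G × S => q.1 • ι q.2) ∘ fun q : G × S => (g⁻¹ * q.1, q.2) := by
    ext q
    simp [smul_smul]
  have hnhds : map (fun q : G × S => (g⁻¹ * q.1, q.2)) (𝓝 (g, y)) = 𝓝 (1, y) := by
    have := ((Homeomorph.mulLeft g⁻¹).prodCongr (Homeomorph.refl S)).map_nhds_eq (g, y)
    simpa [Homeomorph.prodCongr, Prod.map_def] using this
  rw [htrans, ← map_map, ← map_map, hnhds, hone]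
  have := (Homeomorph.smul g).map_nhds_eq (ι y)
  exact this.ge

/-- For a free action with a transverse section, the group element that carries the section to a
given point depends continuously on the point. This is a continuous equivariant map to `G`. -/
theorem IsTransverseSection.exists_continuous_equivariant [IsManifold (𝓡 p) ∞ G]
    [IsManifold (𝓡 d) ∞ M]
    [IsManifold (𝓡 s) ∞ S] [ContinuousMul G] [ContMDiffSMul (𝓡 p) (𝓡 d) ∞ G M]
    (hfree : ∀ (g : G) (x : M), g • x = x → g = 1)
    (hι : IsTransverseSection (p := p) (s := s) (d := d) G ι) :
    ∃ γ : M → G, Continuous γ ∧ ∀ (g : G) (x : M), γ (g • x) = g * γ x := by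
  have hopen := hι.isOpenMap_smul
  have : ContinuousSMul G M := ContMDiffSMul.continuousSMul (I := 𝓡 p) (I' := 𝓡 d) ∞
  have hinj {a b : G} {y z : S} (h : a • ι y = b • ι z) : a = b ∧ y = z := by
    have hyz : y = z := (hι.existsUnique_mem_orbit (a • ι y)).unique
      ⟨a⁻¹, by simp⟩ ⟨b⁻¹, by simp [h]⟩
    subst hyz
    refine ⟨?_, rfl⟩
    have := hfree (b⁻¹ * a) (ι y) (by rw [mul_smul, h, inv_smul_smul])
    exact (inv_mul_eq_one.1 this).symm
  have hex (x : M) : ∃ q : G × S, q.1 • ι q.2 = x := by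
    obtain ⟨y, ⟨g, hg⟩, -⟩ := hι.existsUnique_mem_orbit x
    exact ⟨(g⁻¹, y), by simp [← hg]⟩
  choose r hr using hex
  have hcont : Continuous r := by
    refine continuous_def.2 fun U hU => ?_
    convert hopen U hU using 1
    ext x
    refine ⟨fun hx => ⟨r x, hx, hr x⟩, ?_⟩
    rintro ⟨q, hq, rfl⟩
    have := hinj (hr (q.1 • ι q.2))
    rwa [mem_preimage, show r (q.1 • ι q.2) = q from Prod.ext this.1 this.2]
  refine ⟨fun x => (r x).1, hcont.fst, fun g x => ?_⟩
  refine (hinj (y := (r (g • x)).2) (z := (r x).2) ?_).1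
  rw [hr, mul_smul, hr]

end EquivariantMap

/-! ### Local finiteness of Liouville measures -/

section LocallyFinite

variable {d : ℕ} {M : Type*} [TopologicalSpace M] [ChartedSpace (EuclideanSpace ℝ (Fin d)) M]

theorem SymplecticForm.continuousOn_density (Ω : SymplecticForm d M)
    {φ : OpenPartialHomeomorph M (EuclideanSpace ℝ (Fin d))}
    (hφ : φ ∈ atlas (EuclideanSpace ℝ (Fin d)) M) : ContinuousOn (Ω.density φ) φ.target := by
  have hform : ContinuousOn (formInChart Ω.form φ) φ.target := (Ω.smooth φ hφ).continuousOn
  unfold SymplecticForm.density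
  refine Real.continuous_sqrt.comp_continuousOn ?_
  refine continuous_id.matrix_det.comp_continuousOn ?_
  refine continuousOn_pi.2 fun i => continuousOn_pi.2 fun j => ?_
  exact (continuous_eval_const (F := (EuclideanSpace ℝ (Fin d)) [⋀^Fin 2]→L[ℝ] ℝ)
    ![EuclideanSpace.single i (1 : ℝ), EuclideanSpace.single j (1 : ℝ)]).comp_continuousOn hform

theorem SymplecticForm.IsLiouville.isLocallyFiniteMeasure [MeasurableSpace M] [BorelSpace M]
    {Ω : SymplecticForm d M} {μ : Measure M} (hμ : Ω.IsLiouville μ) :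
    IsLocallyFiniteMeasure μ := by
  refine ⟨fun x => ?_⟩
  set φ := chartAt (EuclideanSpace ℝ (Fin d)) x
  have hφ : φ ∈ atlas (EuclideanSpace ℝ (Fin d)) M := chart_mem_atlas _ x
  have hx : φ x ∈ φ.target := φ.map_source (mem_chart_source _ x)
  have hcont : ContinuousAt (Ω.density φ) (φ x) :=
    (Ω.continuousOn_density hφ).continuousAt (φ.open_target.mem_nhds hx)
  -- an open neighbourhood of `φ x` of finite Lebesgue measure where the density is bounded
  obtain ⟨V, hVsub, hVo, hxV⟩ := mem_nhds_iff.1 (Filter.inter_mem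
    (Filter.inter_mem (φ.open_target.mem_nhds hx) (Metric.ball_mem_nhds (φ x) one_pos))
    (hcont.eventually (gt_mem_nhds (lt_add_one (Ω.density φ (φ x))))))
  have hAo : IsOpen (φ.source ∩ φ ⁻¹' V) := φ.isOpen_inter_preimage hVo
  refine ⟨φ.source ∩ φ ⁻¹' V, hAo.mem_nhds ⟨mem_chart_source _ x, hxV⟩, ?_⟩
  rw [hμ φ hφ _ inter_subset_left hAo.measurableSet]
  have himg : φ '' (φ.source ∩ φ ⁻¹' V) ⊆ V := by
    rintro _ ⟨y, hy, rfl⟩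
    exact hy.2
  calc ∫⁻ y in φ '' (φ.source ∩ φ ⁻¹' V), ENNReal.ofReal (Ω.density φ y)
      ≤ ∫⁻ y in V, ENNReal.ofReal (Ω.density φ y) := lintegral_mono_set himg
    _ ≤ ∫⁻ _ in V, ENNReal.ofReal (Ω.density φ (φ x) + 1) :=
        setLIntegral_mono' hVo.measurableSet fun y hy =>
          ENNReal.ofReal_le_ofReal (hVsub hy).2.le
    _ = ENNReal.ofReal (Ω.density φ (φ x) + 1) * volume V := setLIntegral_const _ _
    _ < ⊤ := ENNReal.mul_lt_top ENNReal.ofReal_lt_top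
        ((measure_mono fun y hy => (hVsub hy).1.2).trans_lt measure_ball_lt_top)

end LocallyFinite

/-! ### Invariant functions as functions of relative position -/

section InvariantFunctions

/-- A function that is invariant almost everywhere under each element of `G` factors, almost
everywhere, through `x ↦ (γ x)⁻¹ • x`, for every measurable `γ : X → G`. The factor is the average
of the function over the orbits with respect to a probability measure equivalent to Haar measure. -/
theorem exists_ae_eq_comp_inv_smul {G X : Type*} [Group G] [TopologicalSpace G]
    [IsTopologicalGroup G] [LocallyCompactSpace G] [SecondCountableTopology G]
    [MeasurableSpace G] [BorelSpace G] [MeasurableSpace X] (μ : Measure X) [SigmaFinite μ]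
    [MulAction G X] [MeasurableSMul₂ G X] (γ : X → G) (f : X → ℂ)
    (hf : Measurable f) (hinv : ∀ g : G, (fun x => f (g • x)) =ᵐ[μ] f) :
    ∃ F : X → ℂ, Measurable F ∧ f =ᵐ[μ] fun x => F ((γ x)⁻¹ • x) := by
  set ν : Measure G := Measure.haar.toFinite with hν
  refine ⟨fun z => ∫ g, f (g • z) ∂ν, ?_, ?_⟩
  · have hm : StronglyMeasurable fun q : X × G => f (q.2 • q.1) :=
      (hf.comp (measurable_snd.smul measurable_fst)).stronglyMeasurable
    exact hm.integral_prod_right'.measurable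
  · have hset : MeasurableSet {q : G × X | f (q.1 • q.2) = f q.2} :=
      measurableSet_eq_fun (hf.comp measurable_smul) (hf.comp measurable_snd)
    have hae : ∀ᵐ x ∂μ, ∀ᵐ g ∂(Measure.haar : Measure G), f (g • x) = f x :=
      (Measure.ae_ae_comm (p := fun g x => f (g • x) = f x) hset).1
        (.of_forall fun g => hinv g)
    filter_upwards [hae] with x hx
    -- right translations preserve the null sets of Haar measure
    have htr : ∀ᵐ g ∂ν, f (g • (γ x)⁻¹ • x) = f x := by
      rw [hν, ae_toFinite]
      filter_upwards [(quasiMeasurePreserving_mul_right Measure.haar (γ x)⁻¹).ae hx] with g hg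
      rwa [smul_smul]
    rw [integral_congr_ae htr]
    simp

end InvariantFunctions

/-! ### Composition with measure preserving maps -/

section CompositionOperators

variable {X : Type*} [MeasurableSpace X] {μ : Measure X}

/-- Multiplication by `f` commutes with composition with a measure preserving map `e` exactly when
`f ∘ e = f`. -/
theorem commute_mulOp_compMeasurePreserving_iff [SigmaFinite μ] (f : Lp ℂ ∞ μ) {e : X → X}
    (he : MeasurePreserving e μ μ) :
    Commute (mulOp μ f) (Lp.compMeasurePreservingₗᵢ ℂ e he).toContinuousLinearMap ↔
      (fun x => f (e x)) =ᵐ[μ] f := by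
  have hW (ψ : Lp ℂ 2 μ) : (Lp.compMeasurePreservingₗᵢ ℂ e he).toContinuousLinearMap ψ
      =ᵐ[μ] fun x => ψ (e x) := Lp.coeFn_compMeasurePreserving ψ he
  have hleft (ψ : Lp ℂ 2 μ) :
      (mulOp μ f * (Lp.compMeasurePreservingₗᵢ ℂ e he).toContinuousLinearMap :
        Lp ℂ 2 μ →L[ℂ] Lp ℂ 2 μ) ψ
        =ᵐ[μ] fun x => f x * ψ (e x) := by
    filter_upwards [mulOp_apply_ae f ((Lp.compMeasurePreservingₗᵢ ℂ e he).toContinuousLinearMap ψ),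
      hW ψ] with x h1 h2
    rw [mul_apply_eq_comp, h1, h2]
  have hright (ψ : Lp ℂ 2 μ) :
      ((Lp.compMeasurePreservingₗᵢ ℂ e he).toContinuousLinearMap * mulOp μ f :
        Lp ℂ 2 μ →L[ℂ] Lp ℂ 2 μ) ψ
        =ᵐ[μ] fun x => f (e x) * ψ (e x) := by
    filter_upwards [hW (mulOp μ f ψ), he.quasiMeasurePreserving.ae (mulOp_apply_ae f ψ)]
      with x h1 h2
    rw [mul_apply_eq_comp, h1, h2]
  constructor
  · intro h
    obtain ⟨ξ, hξ⟩ := exists_Lp_two_ae_ne_zero μ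
    have h1 := hright ξ
    rw [← h.eq] at h1
    filter_upwards [h1, hleft ξ, he.quasiMeasurePreserving.ae hξ] with x e1 e2 e3
    exact mul_right_cancel₀ e3 (e1.symm.trans e2)
  · intro h
    refine ContinuousLinearMap.ext fun ψ => Lp.ext ?_
    filter_upwards [hleft ψ, hright ψ, h] with x h1 h2 h3
    rw [h1, h2, h3]

end CompositionOperators

/-! ### The pair algebras and the invariant algebra -/

section Generation

theorem quasiMeasurePreserving_pair {n : ℕ} {Γ : Fin n → Type*} [∀ k, MeasurableSpace (Γ k)]
    (μ : ∀ k, Measure (Γ k)) [∀ k, SigmaFinite (μ k)] {i k : Fin n} (hik : k ≠ i) :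
    Measure.QuasiMeasurePreserving (fun x : ∀ k, Γ k => (x i, x k)) (Measure.pi μ)
      ((μ i).prod (μ k)) := by
  cases n with
  | zero => exact i.elim0
  | succ n =>
    obtain ⟨j, rfl⟩ := Fin.exists_succAbove_eq hik
    exact (QuasiMeasurePreserving.prodMap (Measure.QuasiMeasurePreserving.id (μ i))
      (Measure.quasiMeasurePreserving_eval (fun j => μ (i.succAbove j)) j)).comp
      (measurePreserving_piFinSuccAbove μ i).quasiMeasurePreserving

variable {n : ℕ} {G : Type*} {Γ : Fin n → Type*} [∀ k, MeasurableSpace (Γ k)]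
  {μ : ∀ k, Measure (Γ k)} [∀ k, SigmaFinite (μ k)]

theorem measurePreserving_smul_pi [∀ k, SMul G (Γ k)] [∀ k, MeasurableConstSMul G (Γ k)]
    [∀ k, SMulInvariantMeasure G (Γ k) (μ k)] (g : G) :
    MeasurePreserving (fun x : ∀ k, Γ k => g • x) (Measure.pi μ) (Measure.pi μ) :=
  measurePreserving_pi μ μ fun k => measurePreserving_smul g (μ k)

theorem star_mem_invariantLinfty {X : Type*} [MeasurableSpace X] {μ : Measure X} [SMul G X]
    (hg : ∀ g : G, Measure.QuasiMeasurePreserving (fun x : X => g • x) μ μ) {f : Lp ℂ ∞ μ}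
    (hf : f ∈ invariantLinfty G μ) : star f ∈ invariantLinfty G μ := by
  intro g
  filter_upwards [hf g, Lp.coeFn_star f, (hg g).ae (Lp.coeFn_star f)] with x h1 h2 h3
  rw [h2, h3, Pi.star_apply, Pi.star_apply, h1]

variable [∀ k, SMul G (Γ k)] [∀ k, MeasurableConstSMul G (Γ k)]
    [∀ k, SMulInvariantMeasure G (Γ k) (μ k)]

theorem pairAlgebra_subset_invariantAlgebra {i k : Fin n} (hik : k ≠ i) :
    pairAlgebra G μ i k ⊆ invariantAlgebra G μ := by
  rintro _ ⟨F, ⟨f, hf, hFf⟩, rfl⟩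
  refine ⟨F, fun g => ?_, rfl⟩
  filter_upwards [hFf, (measurePreserving_smul_pi (μ := μ) g).quasiMeasurePreserving.ae hFf,
    (quasiMeasurePreserving_pair μ hik).ae (hf g)] with x h1 h2 h3
  rw [h1, h2, ← h3]
  rfl

theorem union_star_subset_invariantAlgebra
    {s : Set (Lp ℂ 2 (Measure.pi μ) →L[ℂ] Lp ℂ 2 (Measure.pi μ))}
    (hs : s ⊆ invariantAlgebra G μ) : s ∪ star s ⊆ invariantAlgebra G μ := by
  refine union_subset hs fun T hT => ?_
  obtain ⟨f, hf, hfT⟩ := hs hT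
  refine ⟨star f, star_mem_invariantLinfty
    (fun g => (measurePreserving_smul_pi (μ := μ) g).quasiMeasurePreserving) hf, ?_⟩
  rw [← star_mulOp, hfT, star_star]

/-- The invariant functions form a von Neumann algebra: they are the operators that commute with
all multiplication operators and with the unitary action of `G` on `L²`. -/
theorem vonNeumannGenerated_subset_invariantAlgebra
    {s : Set (Lp ℂ 2 (Measure.pi μ) →L[ℂ] Lp ℂ 2 (Measure.pi μ))}
    (hs : s ⊆ invariantAlgebra G μ) :
    (vonNeumannGenerated s : Set (Lp ℂ 2 (Measure.pi μ) →L[ℂ] Lp ℂ 2 (Measure.pi μ))) ⊆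
      invariantAlgebra G μ := by
  intro T hT
  rw [coe_vonNeumannGenerated] at hT
  have hs' := union_star_subset_invariantAlgebra hs
  obtain ⟨f, rfl⟩ := exists_mulOp_eq_of_commute T fun f => by
    refine (hT _ fun m hm => ?_).symm
    obtain ⟨F, -, rfl⟩ := hs' hm
    exact commute_mulOp F f
  refine ⟨f, fun g => ?_, rfl⟩
  refine (commute_mulOp_compMeasurePreserving_iff f (measurePreserving_smul_pi g)).1
    (hT _ fun m hm => ?_).symm
  obtain ⟨F, hF, rfl⟩ := hs' hm
  exact (commute_mulOp_compMeasurePreserving_iff F (measurePreserving_smul_pi g)).2 (hF g)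

theorem mulOp_indicatorLinfty_mem_pairAlgebra {i k : Fin n} (hik : k ≠ i) {C : Set (Γ i × Γ k)}
    (hC : MeasurableSet C) (hinv : ∀ (g : G) (q : Γ i × Γ k), g • q ∈ C ↔ q ∈ C)
    {A : Set (∀ k, Γ k)} (hA : MeasurableSet A) (hAC : ∀ x, x ∈ A ↔ (x i, x k) ∈ C) :
    mulOp (Measure.pi μ) (indicatorLinfty (Measure.pi μ) A hA) ∈ pairAlgebra G μ i k := by
  have hind := indicatorLinfty_ae (μ := (μ i).prod (μ k)) C hC
  refine ⟨_, ⟨indicatorLinfty ((μ i).prod (μ k)) C hC, fun g => ?_, ?_⟩, rfl⟩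
  · have hmp : MeasurePreserving (fun q : Γ i × Γ k => g • q) ((μ i).prod (μ k))
        ((μ i).prod (μ k)) :=
      (measurePreserving_smul g (μ i)).prod (measurePreserving_smul g (μ k))
    filter_upwards [hind, hmp.quasiMeasurePreserving.ae hind] with q h1 h2
    rw [h1, h2]
    by_cases hq : q ∈ C <;> simp [hq, hinv]
  · filter_upwards [indicatorLinfty_ae (μ := Measure.pi μ) A hA,
      (quasiMeasurePreserving_pair μ hik).ae hind] with x h1 h2
    rw [h1, h2]
    by_cases hx : (x i, x k) ∈ C <;> simp [hx, hAC]

end Generation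

/-! ### Generation by the pair algebras -/

section ReferenceFrame

/-- A measurable equivariant map from `Γ i` to the group makes the object `i` a reference frame:
the invariant functions are functions of the relative positions `(γ xᵢ)⁻¹ • xₖ`. -/
theorem satisfiesFrameAssumption_of_equivariant {n : ℕ} (hn : 2 ≤ n) {G : Type*} [Group G]
    [TopologicalSpace G] [IsTopologicalGroup G] [LocallyCompactSpace G]
    [SecondCountableTopology G] [MeasurableSpace G] [BorelSpace G]
    {Γ : Fin n → Type*} [∀ k, MeasurableSpace (Γ k)]
    {μ : ∀ k, Measure (Γ k)} [∀ k, SigmaFinite (μ k)] [∀ k, MulAction G (Γ k)]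
    [∀ k, MeasurableSMul₂ G (Γ k)] [∀ k, SMulInvariantMeasure G (Γ k) (μ k)] (i : Fin n)
    (γ : Γ i → G) (hγ : Measurable γ) (hequiv : ∀ (g : G) (x : Γ i), γ (g • x) = g * γ x) :
    SatisfiesFrameAssumption G μ i := by
  have : MeasurableSMul₂ G (∀ k, Γ k) :=
    ⟨measurable_pi_lambda _ fun k =>
      measurable_fst.smul ((measurable_pi_apply k).comp measurable_snd)⟩
  refine Subset.antisymm (vonNeumannGenerated_subset_invariantAlgebra
    (iUnion₂_subset fun k hk => pairAlgebra_subset_invariantAlgebra hk)) ?_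
  rintro _ ⟨f, hf, rfl⟩
  rw [coe_vonNeumannGenerated]
  intro T hT
  obtain ⟨F, hF, hfF⟩ := exists_ae_eq_comp_inv_smul (Measure.pi μ) (fun x => γ (x i)) f
    (Lp.stronglyMeasurable f).measurable hf
  set Φ : (∀ k, Γ k) → ∀ k, Γ k := fun x => (γ (x i))⁻¹ • x
  have hΦm : Measurable Φ := (hγ.comp (measurable_pi_apply i)).inv.smul measurable_id
  refine commute_mulOp_of_stronglyMeasurable (m := MeasurableSpace.comap Φ MeasurableSpace.pi)
    T ?_ f (hF.comp (comap_measurable Φ)).stronglyMeasurable hfF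
  -- it suffices to treat the sets `{x | (γ xᵢ)⁻¹ • xₖ ∈ B}`, which depend on two coordinates
  have hrel (k : Fin n) (B : Set (Γ k)) (hB : MeasurableSet B) :
      ∃ j ≠ i, ∃ C : Set (Γ i × Γ j), MeasurableSet C ∧
        (∀ (g : G) (q : Γ i × Γ j), g • q ∈ C ↔ q ∈ C) ∧ ∀ x, Φ x k ∈ B ↔ (x i, x j) ∈ C := by
    by_cases hk : k = i
    · subst hk
      have : Nontrivial (Fin n) := Fin.nontrivial_iff_two_le.2 hn
      obtain ⟨j, hj⟩ := exists_ne k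
      refine ⟨j, hj, {q | (γ q.1)⁻¹ • q.1 ∈ B},
        ((hγ.comp measurable_fst).inv.smul measurable_fst) hB, fun g q => ?_, fun x => Iff.rfl⟩
      simp [hequiv, smul_smul]
    · refine ⟨k, hk, {q | (γ q.1)⁻¹ • q.2 ∈ B},
        ((hγ.comp measurable_fst).inv.smul measurable_snd) hB, fun g q => ?_, fun x => Iff.rfl⟩
      simp [hequiv, smul_smul]
  refine (MeasurableSpace.comap_iSup (g := Φ)
    (m := fun k => MeasurableSpace.comap (fun x => x k) inferInstance)).trans_le
    (iSup_le fun k => ?_)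
  rw [MeasurableSpace.comap_comp]
  rintro _ ⟨B, hB, rfl⟩
  obtain ⟨j, hj, C, hC, hinv, hmem⟩ := hrel k B hB
  have hA : MeasurableSet ((fun x => Φ x k) ⁻¹' B) :=
    ((measurable_pi_apply k).comp hΦm) hB
  refine ⟨hA, (hT _ (Or.inl (mem_iUnion₂.2 ⟨j, hj, ?_⟩))).symm⟩
  exact mulOp_indicatorLinfty_mem_pairAlgebra hj hC hinv hA hmem

end ReferenceFrame

theorem proposition3 {n : ℕ} [NeZero n] (hn : 2 ≤ n)
    -- the Lie group
    {p : ℕ} {G : Type*} [Group G] [TopologicalSpace G] [T2Space G] [SecondCountableTopology G]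
    [ChartedSpace (EuclideanSpace ℝ (Fin p)) G] [LieGroup (𝓡 p) ∞ G]
    -- the phase spaces with their Liouville measures
    {d : Fin n → ℕ} {Γ : Fin n → Type*} [∀ k, TopologicalSpace (Γ k)] [∀ k, T2Space (Γ k)]
    [∀ k, SecondCountableTopology (Γ k)] [∀ k, ChartedSpace (EuclideanSpace ℝ (Fin (d k))) (Γ k)]
    [∀ k, IsManifold (𝓡 (d k)) ∞ (Γ k)] [∀ k, MeasurableSpace (Γ k)] [∀ k, BorelSpace (Γ k)]
    (Ω : ∀ k, SymplecticForm (d k) (Γ k)) (μ : ∀ k, Measure (Γ k))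
    (hμ : ∀ k, (Ω k).IsLiouville (μ k))
    -- the smooth, measure preserving actions
    [∀ k, MulAction G (Γ k)] [∀ k, ContMDiffSMul (𝓡 p) (𝓡 (d k)) ∞ G (Γ k)]
    [∀ k, SMulInvariantMeasure G (Γ k) (μ k)]
    -- the action on the first phase space is free and has a transverse section
    (hfree : ∀ (g : G) (x : Γ 0), g • x = x → g = 1)
    {s : ℕ} {S : Type*} [TopologicalSpace S] [ChartedSpace (EuclideanSpace ℝ (Fin s)) S]
    [IsManifold (𝓡 s) ∞ S] (ι : S → Γ 0)
    (hι : IsTransverseSection (p := p) (s := s) (d := d 0) G ι) :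
    SatisfiesFrameAssumption G μ 0 := by
  have : IsTopologicalGroup G := topologicalGroup_of_lieGroup (𝓡 p) ∞
  have : LocallyCompactSpace G := ChartedSpace.locallyCompactSpace (EuclideanSpace ℝ (Fin p)) G
  borelize G
  have (k : Fin n) : ContinuousSMul G (Γ k) :=
    ContMDiffSMul.continuousSMul (I := 𝓡 p) (I' := 𝓡 (d k)) ∞
  have (k : Fin n) : IsLocallyFiniteMeasure (μ k) := (hμ k).isLocallyFiniteMeasure
  obtain ⟨γ, hγ, hequiv⟩ := hι.exists_continuous_equivariant hfree
  exact satisfiesFrameAssumption_of_equivariant hn 0 γ hγ.measurable hequiv
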